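/- Let $V=V_1\sqcup V_2$ be a set of nodes with $|V_1|=n_1\ge 1$ nodes of type 1, $|V_2|=n_2\ge 1$ nodes of type 2, and $n=n_1+n_2$. A network $s$ on $V$ consists of two disjoint sets $\mathcal E_P$ (protected links) and $\mathcal E_{NP}$ (non-protected links) of unordered pairs of distinct nodes. For integers $k_1,k_2\ge 0$ the network is $(k_1,k_2)$-resistant if for every $\mathcal E_A\subseteq\mathcal E_{NP}$ the graph $(V,\mathcal E_P\cup(\mathcal E_{NP}\setminus\mathcal E_A))$ contains a path between any two nodes of $V$ whenever $|\mathcal E_A|\le k_1$, and a path between any two nodes of $V_2$ whenever $|\mathcal E_A|\le k_2$. Given unit costs $0<c_{NP}\le c_P$, a network is optimal for $(k_1,k_2)$ if it is $(k_1,k_2)$-resistant and minimizes $c_P|\mathcal E_P|+c_{NP}|\mathcal E_{NP}|$ among all $(k_1,k_2)$-resistant networks on $V$. An $s^D_p$ for $(k_1,k_2)$ is a $(k_1,k_2)$-resistant network with exactly $p$ protected links and the least possible number of non-protected links among such networks. A pair $(k_1,k_2)$ is called admissible if $n_1\ge k_1+1$, $n_2\ge k_2-k_1+1$, $n_2\frac{k_1+1}{2}\le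 n_1$, $k_1$ is odd and $n_2(k_2+1)$ is even. Let $k_1\le k_2$. 1. If a network $s$ is an $s^D_{n-1}$ for $(k_1,k_2)$ and is optimal for $(k_1,k_2)$, then $s$ is optimal for $(k_1',k_2')$, for all $k_1'>k_1$ and all $k_2'>k_2$. Assume in addition that $(k_1,k_2)$ is admissible. 2. If a network $s$ is an $s^D_{n_2-1}$ for $(k_1,k_2)$ and is optimal for $(k_1,k_2)$, then $s$ is optimal for $(k_1,k_2')$, for all $k_2'>k_2$. 3. If a network $s$ is an $s^D_0$ for $(k_1,k_2)$ and is optimal for $(k_1,k_2)$, then $s$ is not optimal for any $(k_1',k_2')$ with $k_1'\ne k_1$ and $k_2'\ne k_2$. Moreover, $s$ is not optimal for any pair $(k_1',k_2')\ne(k_1,k_2)$ with $k_1'\le k_2'$ such that either $n_2\ge 2$ and $k_1'\ge k_1$, or $(k_1',k_2')$ is admissible. -/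

import Mathlib

/-- The nodes of a two-layer network: `n₁` nodes of type 1 and `n₂` nodes of type 2. -/
abbrev Node (n₁ n₂ : ℕ) : Type := Fin n₁ ⊕ Fin n₂

/-- A design on `n₁ + n₂` nodes: a set of protected links and a disjoint set of non-protected
links, a link being an unordered pair of distinct nodes. -/
structure Network (n₁ n₂ : ℕ) where
  /-- the protected links -/
  prot : Finset (Sym2 (Node n₁ n₂))
  /-- the non-protected links -/
  unprot : Finset (Sym2 (Node n₁ n₂))
  prot_not_diag : ∀ e ∈ prot, ¬ e.IsDiag
  unprot_not_diag : ∀ e ∈ unprot, ¬ e.IsDiag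
  disj : Disjoint prot unprot

namespace Network

variable {n₁ n₂ : ℕ}

/-- The graph that is left after the attacker has removed the links in `A`. -/
def residual (s : Network n₁ n₂) (A : Finset (Sym2 (Node n₁ n₂))) : SimpleGraph (Node n₁ n₂) :=
  SimpleGraph.fromEdgeSet (↑(s.prot ∪ (s.unprot \ A)) : Set (Sym2 (Node n₁ n₂)))

/-- `(k₁, k₂)`-resistance: all nodes remain mutually reachable after the removal of any at most
`k₁` non-protected links, and all nodes of type 2 remain mutually reachable (possibly through
nodes of type 1) after the removal of any at most `k₂` non-protected links. -/
def IsResistant (s : Network n₁ n₂) (k₁ k₂ : ℕ) : Prop :=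
  (∀ A ⊆ s.unprot, A.card ≤ k₁ → ∀ i j : Node n₁ n₂, (s.residual A).Reachable i j) ∧
  (∀ A ⊆ s.unprot, A.card ≤ k₂ →
    ∀ i j : Fin n₂, (s.residual A).Reachable (Sum.inr i) (Sum.inr j))

/-- The cost of a design, `cP` per protected and `cNP` per non-protected link. -/
def cost (s : Network n₁ n₂) (cP cNP : ℝ) : ℝ :=
  cP * s.prot.card + cNP * s.unprot.card

/-- `s` is an optimal strategy for `(k₁, k₂)`: a `(k₁, k₂)`-resistant network of least cost among
all `(k₁, k₂)`-resistant networks on the same nodes. -/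
def IsOptimal (s : Network n₁ n₂) (cP cNP : ℝ) (k₁ k₂ : ℕ) : Prop :=
  s.IsResistant k₁ k₂ ∧
    ∀ t : Network n₁ n₂, t.IsResistant k₁ k₂ → s.cost cP cNP ≤ t.cost cP cNP

/-- `s` is an `s^D_p` for `(k₁, k₂)`: a `(k₁, k₂)`-resistant network with `p` protected links that
has the least number of non-protected links among all such networks. -/
def IsSD (s : Network n₁ n₂) (p k₁ k₂ : ℕ) : Prop :=
  s.IsResistant k₁ k₂ ∧ s.prot.card = p ∧
    ∀ t : Network n₁ n₂, t.IsResistant k₁ k₂ → t.prot.card = p →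
      s.unprot.card ≤ t.unprot.card

end Network

/-- The considered range of parameters: `n₁ ≥ k₁ + 1`, `n₂ ≥ k₂ - k₁ + 1`, `n₂ (k₁ + 1) / 2 ≤ n₁`,
`k₁` odd and `n₂ (k₂ + 1)` even (written without subtraction and division). -/
def Scenario (n₁ n₂ k₁ k₂ : ℕ) : Prop :=
  k₁ + 1 ≤ n₁ ∧ k₂ + 1 ≤ n₂ + k₁ ∧ n₂ * (k₁ + 1) ≤ 2 * n₁ ∧ Odd k₁ ∧ Even (n₂ * (k₂ + 1))

/-! By `isResistant_iff`, resistance is a statement about cuts: every bipartition that no protected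
link crosses is crossed by at least `k₁ + 1` non-protected links, and by at least `k₂ + 1` if it
separates two nodes of type 2. Raising the resistances only shrinks the set of competitors, so for
the first two claims it suffices that `s` resists the larger attacks.

Claim 1: a protected spanning star needs no other links, so `s` has no non-protected links and no
cut is left to be attacked.

Claim 2: it suffices that the protected links join all nodes of type 2. Otherwise contracting them
leaves at least `n₁ + 1` classes, and counting degrees against a backbone network (protected star on
type 2, circulant on the rest) forces `k₁ = k₂` and equality. Comparing costs with a protected tree
and with a network without protected links then gives contradictory bounds on `cP / cNP`.

Claim 3: without protected links, twice the number of links is at least the sum of the required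
degrees, and this bound is attained. So `s` cannot resist more, and for a smaller pair a cheaper
network is exhibited. The attaining network (`Scenario.exists_links`) is a circulant of radius `(k₁
+ 1) / 2` on all nodes, with the nodes of type 2 spaced too far apart to be adjacent in it, plus a
Harary-type graph among them. The delicate case is `k₂ - k₁` odd: a bipartition that cuts no
antipodal link is symmetric on type 2, so it changes sides often enough to cut an additional
circulant link. -/

/-! ### Changes of value along the chords of a cycle -/

/-- The number of steps `d` with `1 ≤ d ≤ h` along which `f` changes value from `x`. -/
def changeCount (f : ℕ → Bool) (h x : ℕ) : ℕ :=
  ((Finset.Icc 1 h).filter fun d => f x ≠ f (x + d)).card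

theorem Function.Periodic.sum_range_add {M : Type*} [AddCommMonoid M] {g : ℕ → M} {n : ℕ}
    (hg : Function.Periodic g n) (a : ℕ) :
    ∑ x ∈ Finset.range n, g (x + a) = ∑ x ∈ Finset.range n, g x := by
  induction a with
  | zero => simp
  | succ a ih =>
    rw [← ih]
    have h1 := Finset.sum_range_succ (fun x => g (x + a)) n
    have h2 := Finset.sum_range_succ' (fun x => g (x + a)) n
    cases n with
    | zero => simp
    | succ m =>
      rw [Finset.sum_range_succ, Finset.sum_range_succ' (fun x => g (x + a))]
      congr 1
      · exact Finset.sum_congr rfl fun x _ => by congr 1; ring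
      · rw [← hg (0 + a)]; congr 1; ring

/-- Modulo 2 a change is `f x + f (x + d)`, and both terms have the same sum over a period. -/
theorem Function.Periodic.even_card_change {f : ℕ → Bool} {n : ℕ} (hf : Function.Periodic f n)
    (d : ℕ) : Even ((Finset.range n).filter fun x => f x ≠ f (x + d)).card := by
  rw [← ZMod.natCast_eq_zero_iff_even, Finset.card_filter, Nat.cast_sum]
  have hg : Function.Periodic (fun x => if f x then (1 : ZMod 2) else 0) n := by
    intro x; simp only [hf x]
  have key := hg.sum_range_add d
  have : ∑ x ∈ Finset.range n, (((if f x ≠ f (x + d) then 1 else 0 : ℕ)) : ZMod 2) =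
      ∑ x ∈ Finset.range n, ((if f x then (1 : ZMod 2) else 0) +
        if f (x + d) then (1 : ZMod 2) else 0) := by
    refine Finset.sum_congr rfl fun x _ => ?_
    cases f x <;> cases f (x + d) <;> (simp; try decide)
  rw [this, Finset.sum_add_distrib, key, ← two_mul]
  have : (2 : ZMod 2) = 0 := by decide
  rw [this, zero_mul]

theorem Function.Periodic.even_sum_changeCount {f : ℕ → Bool} {n : ℕ}
    (hf : Function.Periodic f n) (h : ℕ) :
    Even (∑ x ∈ Finset.range n, changeCount f h x) := by
  have : ∑ x ∈ Finset.range n, changeCount f h x =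
      ∑ d ∈ Finset.Icc 1 h, ((Finset.range n).filter fun x => f x ≠ f (x + d)).card := by
    simp only [changeCount, Finset.card_filter]
    exact Finset.sum_comm
  rw [this]
  exact Finset.even_sum _ fun d _ => hf.even_card_change d

theorem Function.Periodic.changeCount {f : ℕ → Bool} {n : ℕ}
    (hf : Function.Periodic f n) (h : ℕ) : Function.Periodic (changeCount f h) n := by
  intro x
  simp only [_root_.changeCount]
  congr 1
  refine Finset.filter_congr fun d _ => ?_
  rw [hf x, show x + n + d = x + d + n by ring, hf]

/-- A change of value between `a + k` and `a + k + 1` forces many changes nearby. -/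
theorem le_sum_changeCount_of_change {f : ℕ → Bool} {a k : ℕ} (hc : f (a + k) ≠ f (a + k + 1)) :
    2 * k + 1 ≤ ∑ x ∈ Finset.Ico a (a + k + 2), changeCount f (k + 1) x := by
  rw [Finset.sum_Ico_succ_top (by omega), Finset.sum_Ico_succ_top (by omega)]
  -- Each of the `k` earlier starts differs from one of the two ends of the change, and both are
  -- within reach.
  have h1 : k ≤ ∑ x ∈ Finset.Ico a (a + k), changeCount f (k + 1) x := by
    calc k = ∑ x ∈ Finset.Ico a (a + k), 1 := by simp
      _ ≤ _ := by
        refine Finset.sum_le_sum fun x hx => ?_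
        rw [Finset.mem_Ico] at hx
        refine Finset.card_pos.2 ?_
        by_cases hx' : f x = f (a + k)
        · refine ⟨a + k + 1 - x, ?_⟩
          rw [Finset.mem_filter, Finset.mem_Icc, show x + (a + k + 1 - x) = a + k + 1 by omega]
          exact ⟨by omega, hx' ▸ hc⟩
        · refine ⟨a + k - x, ?_⟩
          rw [Finset.mem_filter, Finset.mem_Icc, show x + (a + k - x) = a + k by omega]
          exact ⟨by omega, hx'⟩
  -- The two ends have `k` further targets in common, each differing from one of them; the change
  -- itself is the last chord.
  have h2 : k + 1 ≤ changeCount f (k + 1) (a + k) + changeCount f (k + 1) (a + k + 1) := by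
    have e1 : changeCount f (k + 1) (a + k) =
        ∑ d ∈ Finset.range (k + 1), if f (a + k) ≠ f (a + k + (d + 1)) then 1 else 0 := by
      rw [changeCount, Finset.card_filter, Finset.range_eq_Ico,
        Finset.sum_Ico_add' (fun d => if f (a + k) ≠ f (a + k + d) then 1 else 0) 0 (k + 1) 1]
      rfl
    have e2 : changeCount f (k + 1) (a + k + 1) =
        ∑ d ∈ Finset.range (k + 1), if f (a + k + 1) ≠ f (a + k + 1 + (d + 1)) then 1 else 0 := by
      rw [changeCount, Finset.card_filter, Finset.range_eq_Ico,
        Finset.sum_Ico_add' (fun d => if f (a + k + 1) ≠ f (a + k + 1 + d) then 1 else 0)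
          0 (k + 1) 1]
      rfl
    rw [e1, e2, Finset.sum_range_succ', Finset.sum_range_succ]
    have : k ≤ ∑ d ∈ Finset.range k, (if f (a + k) ≠ f (a + k + (d + 1 + 1)) then 1 else 0) +
        ∑ d ∈ Finset.range k, (if f (a + k + 1) ≠ f (a + k + 1 + (d + 1)) then 1 else 0) := by
      rw [← Finset.sum_add_distrib]
      calc k = ∑ d ∈ Finset.range k, 1 := by simp
        _ ≤ _ := by
          refine Finset.sum_le_sum fun d _ => ?_
          rw [show a + k + (d + 1 + 1) = a + k + 1 + (d + 1) by ring]
          revert hc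
          cases f (a + k) <;> cases f (a + k + 1) <;> cases f (a + k + 1 + (d + 1)) <;> simp
    have h3 : (if f (a + k) ≠ f (a + k + (0 + 1)) then 1 else 0) = 1 := if_pos hc
    omega
  omega

theorem exists_change_of_ne {f : ℕ → Bool} {x y : ℕ} (hxy : x ≤ y) (h : f x ≠ f y) :
    ∃ i, x ≤ i ∧ i < y ∧ f i ≠ f (i + 1) := by
  induction y, hxy using Nat.le_induction with
  | base => exact absurd rfl h
  | succ y hxy ih =>
    by_cases hy : f x = f y
    · exact ⟨y, hxy, by omega, hy ▸ h⟩
    · obtain ⟨i, h1, h2, h3⟩ := ih hy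
      exact ⟨i, h1, by omega, h3⟩

theorem Function.Periodic.sum_range_changeCount_eq {f : ℕ → Bool} {n : ℕ}
    (hf : Function.Periodic f n) (h a : ℕ) :
    ∑ x ∈ Finset.range n, _root_.changeCount f h x =
      ∑ x ∈ Finset.Ico a (a + n), _root_.changeCount f h x := by
  rw [← (hf.changeCount h).sum_range_add a, Finset.range_eq_Ico,
    Finset.sum_Ico_add' (fun x => _root_.changeCount f h x) 0 n a, zero_add, add_comm]

/-- A nonconstant function on a cycle changes value along at least `2 * h` chords of length at
most `h`. -/
theorem Function.Periodic.two_mul_le_sum_changeCount {f : ℕ → Bool} {n h : ℕ}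
    (hf : Function.Periodic f n) (hn : h < n) {x y : ℕ} (hxy : f x ≠ f y) :
    2 * h ≤ ∑ x ∈ Finset.range n, _root_.changeCount f h x := by
  obtain _ | k := h
  · simp
  obtain ⟨i, hi⟩ : ∃ i, f i ≠ f (i + 1) := by
    rcases le_total x y with hle | hle
    · obtain ⟨i, -, -, hi⟩ := exists_change_of_ne hle hxy
      exact ⟨i, hi⟩
    · obtain ⟨i, -, -, hi⟩ := exists_change_of_ne hle hxy.symm
      exact ⟨i, hi⟩
  -- Shifting by a period lets the window start `k` steps before `i`. It yields `2 * h - 1` changes;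
  -- parity supplies the missing one.
  have hi' : f (i + n - k + k) ≠ f (i + n - k + k + 1) := by
    rw [show i + n - k + k = i + n by omega, show i + n + 1 = i + 1 + n by ring, hf, hf]
    exact hi
  have h1 := le_sum_changeCount_of_change hi'
  have h2 := hf.even_sum_changeCount (k + 1)
  have h3 := hf.sum_range_changeCount_eq (k + 1) (i + n - k)
  have h4 : ∑ x ∈ Finset.Ico (i + n - k) (i + n - k + k + 2), _root_.changeCount f (k + 1) x ≤
      ∑ x ∈ Finset.Ico (i + n - k) (i + n - k + n), _root_.changeCount f (k + 1) x :=
    Finset.sum_le_sum_of_subset (Finset.Ico_subset_Ico le_rfl (by omega))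
  obtain ⟨c, hc⟩ := h2
  omega

/-- Two changes of value that are far apart on the cycle, with another one in between, force an
additional change along the chords of length at most `h`. -/
theorem Function.Periodic.two_mul_add_one_le_sum_changeCount {f : ℕ → Bool} {n h : ℕ}
    (hf : Function.Periodic f n) (hh : 1 ≤ h) {i j l : ℕ} (hij : i < j) (hjl : j < l)
    (hil : i + h + 1 ≤ l) (hln : l + h + 1 ≤ i + n)
    (hi : f i ≠ f (i + 1)) (hj : f j ≠ f (j + 1)) (hl : f l ≠ f (l + 1)) :
    2 * h + 1 ≤ ∑ x ∈ Finset.range n, _root_.changeCount f h x := by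
  -- For `h ≥ 2` the disjoint windows at `i` and `l` give `2 * (2 * h - 1) ≥ 2 * h + 1`. For `h = 1`
  -- this is only 2, and the third change at `j` is needed.
  obtain rfl | hh2 := hh.eq_or_lt
  · rw [hf.sum_range_changeCount_eq 1 i]
    have hsub : ({i, j, l} : Finset ℕ) ⊆ Finset.Ico i (i + n) := by
      intro x hx
      simp only [Finset.mem_insert, Finset.mem_singleton] at hx
      rw [Finset.mem_Ico]; omega
    refine le_trans ?_ (Finset.sum_le_sum_of_subset hsub)
    have hpos : ∀ x, f x ≠ f (x + 1) → 1 ≤ _root_.changeCount f 1 x := fun x hx =>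
      Finset.card_pos.2 ⟨1, by simpa using hx⟩
    rw [Finset.sum_insert (by simp; omega), Finset.sum_insert (by simp; omega),
      Finset.sum_singleton]
    have := hpos i hi; have := hpos j hj; have := hpos l hl
    omega
  · obtain ⟨k, rfl⟩ : ∃ k, h = k + 1 := ⟨h - 1, by omega⟩
    have hi' : f (i + n - k + k) ≠ f (i + n - k + k + 1) := by
      rw [show i + n - k + k = i + n by omega, show i + n + 1 = i + 1 + n by ring, hf, hf]
      exact hi
    have hl' : f (l + n - k + k) ≠ f (l + n - k + k + 1) := by
      rw [show l + n - k + k = l + n by omega, show l + n + 1 = l + 1 + n by ring, hf, hf]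
      exact hl
    have h1 := le_sum_changeCount_of_change hi'
    have h2 := le_sum_changeCount_of_change hl'
    rw [hf.sum_range_changeCount_eq (k + 1) (i + n - k)]
    have h3 := Finset.sum_le_sum_of_subset (f := _root_.changeCount f (k + 1))
      (s := Finset.Ico (i + n - k) (i + n - k + k + 2) ∪
        Finset.Ico (l + n - k) (l + n - k + k + 2))
      (t := Finset.Ico (i + n - k) (i + n - k + n)) (by
        intro x hx
        simp only [Finset.mem_union, Finset.mem_Ico] at hx ⊢
        omega)
    rw [Finset.sum_union (by
      rw [Finset.disjoint_left]; intro x hx hx'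
      rw [Finset.mem_Ico] at hx hx'; omega)] at h3
    omega

/-! ### Cuts, reachability and contraction of links -/

/-- The link `e` joins the two sides of the bipartition `P`. -/
def Sym2.Crosses {α : Type*} (P : α → Bool) (e : Sym2 α) : Prop := ¬ (e.map P).IsDiag

instance {α : Type*} (P : α → Bool) : DecidablePred (Sym2.Crosses P) := fun e =>
  inferInstanceAs (Decidable (¬ (e.map P).IsDiag))

@[simp] theorem Sym2.crosses_mk {α : Type*} (P : α → Bool) (u v : α) :
    Sym2.Crosses P s(u, v) ↔ P u ≠ P v := by
  simp [Sym2.Crosses]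

/-- The number of links of `E` that join the two sides of the bipartition `P`. -/
def cutSize {α : Type*} (E : Finset (Sym2 α)) (P : α → Bool) : ℕ :=
  (E.filter (Sym2.Crosses P)).card

theorem cutSize_union {α : Type*} [DecidableEq α] {E F : Finset (Sym2 α)} (h : Disjoint E F)
    (P : α → Bool) : cutSize (E ∪ F) P = cutSize E P + cutSize F P := by
  rw [cutSize, Finset.filter_union, Finset.card_union_of_disjoint]
  · rfl
  · exact Finset.disjoint_filter_filter h

theorem le_cutSize_erase {α : Type*} [DecidableEq α] (E : Finset (Sym2 α)) (e : Sym2 α)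
    (P : α → Bool) : cutSize E P ≤ cutSize (E.erase e) P + 1 := by
  rw [cutSize, cutSize, Finset.filter_erase]
  have := Finset.pred_card_le_card_erase (s := E.filter (Sym2.Crosses P)) (a := e)
  omega

/-- An uncrossed bipartition is constant along walks; conversely, test with the indicator of the
component of `u`. -/
theorem SimpleGraph.reachable_fromEdgeSet_iff {α : Type*} {E : Set (Sym2 α)} {u v : α} :
    (SimpleGraph.fromEdgeSet E).Reachable u v ↔
      ∀ P : α → Bool, (∀ e ∈ E, ¬ Sym2.Crosses P e) → P u = P v := by
  classical
  constructor
  · rintro ⟨w⟩ P hP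
    induction w with
    | nil => rfl
    | cons h _ ih =>
      rw [← ih]
      have := hP _ ((SimpleGraph.fromEdgeSet_adj E).1 h).1
      simpa using this
  · intro h
    have := h (fun x => decide ((SimpleGraph.fromEdgeSet E).Reachable u x)) (by
      intro e
      induction e with | _ a b
      intro he
      rw [Sym2.crosses_mk, not_not]
      by_cases hab : a = b
      · rw [hab]
      · have hadj : (SimpleGraph.fromEdgeSet E).Adj a b :=
          (SimpleGraph.fromEdgeSet_adj E).2 ⟨he, hab⟩
        exact decide_eq_decide.2 ⟨fun hr => hr.trans hadj.reachable,
          fun hr => hr.trans hadj.symm.reachable⟩)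
    have hu : (SimpleGraph.fromEdgeSet E).Reachable u u := SimpleGraph.Reachable.refl u
    simpa [hu] using this

/-- Every link belongs to the boundary of at most two of the fibres of `π`. -/
theorem sum_cutSize_fiber_le {α β : Type*} [DecidableEq β] (E : Finset (Sym2 α)) (π : α → β)
    (C : Finset β) : ∑ c ∈ C, cutSize E (fun x => decide (π x = c)) ≤ 2 * E.card := by
  simp only [cutSize, Finset.card_filter]
  rw [Finset.sum_comm, mul_comm, ← smul_eq_mul]
  refine Finset.sum_le_card_nsmul _ _ _ fun e _ => ?_
  induction e with | _ u v
  rw [← Finset.card_filter]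
  refine le_trans (Finset.card_le_card (t := {π u, π v}) ?_) Finset.card_le_two
  intro c hc
  rw [Finset.mem_filter, Sym2.crosses_mk] at hc
  simp only [Finset.mem_insert, Finset.mem_singleton]
  by_contra hne
  push Not at hne
  exact hc.2 (by rw [decide_eq_false hne.1.symm, decide_eq_false hne.2.symm])

/-- Merging along the links of `E` leaves at least `|α| - |E|` classes. -/
theorem exists_classes {α : Type*} [Fintype α] [DecidableEq α] (E : Finset (Sym2 α)) :
    ∃ π : α → α, (∀ e ∈ E, (e.map π).IsDiag) ∧
      (∀ P : α → Bool, (∀ e ∈ E, ¬ Sym2.Crosses P e) → ∀ u v, π u = π v → P u = P v) ∧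
      Fintype.card α ≤ (Finset.univ.image π).card + E.card := by
  induction E using Finset.induction_on with
  | empty =>
    exact ⟨id, by simp, fun P _ u v h => congrArg P h, by simp⟩
  | insert e E he ih =>
    obtain ⟨π, h1, h2, h3⟩ := ih
    induction e with | _ a b
    -- Renaming the value `π b` to `π a` loses at most one class.
    refine ⟨fun x => if π x = π b then π a else π x, ?_, ?_, ?_⟩
    · intro e' he'
      rw [Finset.mem_insert] at he'
      rcases he' with rfl | he'
      · simp
      · have := h1 e' he'
        induction e' with | _ c d
        have hcd : π c = π d := by simpa using this
        simp [hcd]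
    · intro P hP u v huv
      have hP' := h2 P fun e' he' => hP e' (Finset.mem_insert_of_mem he')
      have hab : P a = P b := by simpa using hP s(a, b) (Finset.mem_insert_self _ _)
      dsimp only at huv
      split_ifs at huv with hu hv hv
      · exact hP' _ _ (hu.trans hv.symm)
      · rw [hP' _ _ hu, ← hab, hP' _ _ huv]
      · rw [hP' _ _ hv, ← hab, hP' _ _ huv]
      · exact hP' _ _ huv
    · have hsub : (Finset.univ.image π).erase (π b) ⊆
          Finset.univ.image fun x => if π x = π b then π a else π x := by
        intro c hc
        rw [Finset.mem_erase, Finset.mem_image] at hc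
        obtain ⟨hcb, x, -, rfl⟩ := hc
        exact Finset.mem_image.2 ⟨x, Finset.mem_univ _, if_neg hcb⟩
      have := Finset.card_le_card hsub
      have := Finset.pred_card_le_card_erase (s := Finset.univ.image π) (a := π b)
      rw [Finset.card_insert_of_notMem he]
      omega

/-! ### Resistance in terms of cuts, and degree bounds -/

namespace Network

variable {n₁ n₂ : ℕ}

theorem IsResistant.mono {s : Network n₁ n₂} {k₁ k₂ l₁ l₂ : ℕ} (h : s.IsResistant k₁ k₂)
    (h₁ : l₁ ≤ k₁) (h₂ : l₂ ≤ k₂) : s.IsResistant l₁ l₂ :=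
  ⟨fun A hA hc => h.1 A hA (hc.trans h₁), fun A hA hc => h.2 A hA (hc.trans h₂)⟩

theorem reachable_residual_iff {s : Network n₁ n₂} {A : Finset (Sym2 (Node n₁ n₂))}
    {u v : Node n₁ n₂} : (s.residual A).Reachable u v ↔
      ∀ P : Node n₁ n₂ → Bool, (∀ e ∈ s.prot, ¬ Sym2.Crosses P e) →
        (∀ e ∈ s.unprot, Sym2.Crosses P e → e ∈ A) → P u = P v := by
  rw [residual, SimpleGraph.reachable_fromEdgeSet_iff]
  refine forall_congr' fun P => ?_
  simp only [Finset.coe_union, Finset.coe_sdiff, Set.mem_union, Set.mem_sdiff, Finset.mem_coe]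
  constructor
  · intro h h1 h2
    refine h fun e he hc => ?_
    rcases he with he | he
    · exact h1 e he hc
    · exact he.2 (h2 e he.1 hc)
  · intro h h1
    exact h (fun e he => h1 e (Or.inl he)) fun e he hc => by
      by_contra hA
      exact h1 e (Or.inr ⟨he, hA⟩) hc

/-- Cut characterization of the reachability of two nodes under all attacks of size `k`. -/
theorem forall_reachable_iff {s : Network n₁ n₂} {k : ℕ} {u v : Node n₁ n₂} :
    (∀ A ⊆ s.unprot, A.card ≤ k → (s.residual A).Reachable u v) ↔
      ∀ P : Node n₁ n₂ → Bool, P u ≠ P v → (∀ e ∈ s.prot, ¬ Sym2.Crosses P e) →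
        k + 1 ≤ cutSize s.unprot P := by
  simp only [reachable_residual_iff]
  constructor
  · intro h P hP hp
    by_contra hlt
    -- The worst attack removes exactly the links that cross `P`.
    refine hP (h (s.unprot.filter (Sym2.Crosses P)) (Finset.filter_subset _ _) ?_ P hp
      fun e he hc => Finset.mem_filter.2 ⟨he, hc⟩)
    rw [cutSize] at hlt
    omega
  · intro h A _ hA P hp hu
    by_contra hP
    have h1 := h P hP hp
    have h2 : cutSize s.unprot P ≤ A.card := Finset.card_le_card fun e he => by
      rw [Finset.mem_filter] at he
      exact hu e he.1 he.2
    omega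

theorem isResistant_iff {s : Network n₁ n₂} {k₁ k₂ : ℕ} : s.IsResistant k₁ k₂ ↔
    (∀ (P : Node n₁ n₂ → Bool) (u v : Node n₁ n₂), P u ≠ P v →
      (∀ e ∈ s.prot, ¬ Sym2.Crosses P e) → k₁ + 1 ≤ cutSize s.unprot P) ∧
    (∀ (P : Node n₁ n₂ → Bool) (i j : Fin n₂), P (Sum.inr i) ≠ P (Sum.inr j) →
      (∀ e ∈ s.prot, ¬ Sym2.Crosses P e) → k₂ + 1 ≤ cutSize s.unprot P) := by
  constructor
  · intro h
    exact ⟨fun P u v => forall_reachable_iff.1 (fun A hA hc => h.1 A hA hc u v) P,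
      fun P i j => forall_reachable_iff.1 (fun A hA hc => h.2 A hA hc i j) P⟩
  · intro h
    exact ⟨fun A hA hc u v => forall_reachable_iff.2 (fun P => h.1 P u v) A hA hc,
      fun A hA hc i j => forall_reachable_iff.2 (fun P => h.2 P _ _) A hA hc⟩

/-- Removing one non-protected link lowers both resistances by at most one. -/
theorem IsResistant.exists_remove {s : Network n₁ n₂} {k₁ k₂ : ℕ}
    (h : s.IsResistant (k₁ + 1) (k₂ + 1)) {e : Sym2 (Node n₁ n₂)} (he : e ∈ s.unprot) :
    ∃ t : Network n₁ n₂, t.IsResistant k₁ k₂ ∧ t.prot = s.prot ∧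
      t.unprot.card + 1 = s.unprot.card := by
  refine ⟨⟨s.prot, s.unprot.erase e, s.prot_not_diag,
    fun e' he' => s.unprot_not_diag e' (Finset.mem_of_mem_erase he'),
    s.disj.mono_right (Finset.erase_subset _ _)⟩, ?_, rfl, Finset.card_erase_add_one he⟩
  rw [isResistant_iff] at h ⊢
  refine ⟨fun P u v hP hp => ?_, fun P i j hP hp => ?_⟩
  · have := h.1 P u v hP hp
    have := le_cutSize_erase s.unprot e P
    dsimp only; omega
  · have := h.2 P i j hP hp
    have := le_cutSize_erase s.unprot e P
    dsimp only; omega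

theorem IsOptimal.of_isResistant {s : Network n₁ n₂} {cP cNP : ℝ} {k₁ k₂ l₁ l₂ : ℕ}
    (h : s.IsOptimal cP cNP k₁ k₂) (h₁ : k₁ ≤ l₁) (h₂ : k₂ ≤ l₂) (hl : s.IsResistant l₁ l₂) :
    s.IsOptimal cP cNP l₁ l₂ :=
  ⟨hl, fun t ht => h.2 t (ht.mono h₁ h₂)⟩

/-- If all nodes of type 2 are joined by protected links, the second resistance is unbounded. -/
theorem IsResistant.of_prot {s : Network n₁ n₂} {k₁ k₂ : ℕ} (h : s.IsResistant k₁ k₂)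
    (hs : ∀ P : Node n₁ n₂ → Bool, (∀ e ∈ s.prot, ¬ Sym2.Crosses P e) →
      ∀ i j : Fin n₂, P (Sum.inr i) = P (Sum.inr j)) (l : ℕ) : s.IsResistant k₁ l := by
  rw [isResistant_iff] at h ⊢
  exact ⟨h.1, fun P i j hP hp => absurd (hs P hp i j) hP⟩

/-- Counting the links at the classes of nodes that are joined by protected links. -/
theorem IsResistant.mul_card_classes_le {s : Network n₁ n₂} {k₁ k₂ : ℕ}
    (h : s.IsResistant k₁ k₂) {π : Node n₁ n₂ → Node n₁ n₂}
    (hπ : ∀ e ∈ s.prot, (e.map π).IsDiag) {i j : Fin n₂}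
    (hij : π (Sum.inr i) ≠ π (Sum.inr j)) (hk : k₁ ≤ k₂) :
    (Finset.univ.image π).card * (k₁ + 1) + 2 * (k₂ - k₁) ≤ 2 * s.unprot.card := by
  rw [isResistant_iff] at h
  refine le_trans ?_ (sum_cutSize_fiber_le s.unprot π (Finset.univ.image π))
  have hp : ∀ c, ∀ e ∈ s.prot, ¬ Sym2.Crosses (fun x => decide (π x = c)) e := by
    intro c e he
    have := hπ e he
    induction e with | _ u v
    have huv : π u = π v := by simpa using this
    simp [huv]
  have hne : ∀ c, ∃ v, π v ≠ c := by
    intro c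
    by_cases hc : π (Sum.inr i) = c
    · exact ⟨Sum.inr j, fun h' => hij (hc.trans h'.symm)⟩
    · exact ⟨Sum.inr i, hc⟩
  -- The classes of `i` and `j` each separate two nodes of type 2, whence the surplus `k₂ - k₁` at
  -- both.
  have h1 : ∀ c ∈ Finset.univ.image π,
      (k₁ + 1) + (if c ∈ ({π (Sum.inr i), π (Sum.inr j)} : Finset _) then k₂ - k₁ else 0) ≤
        cutSize s.unprot (fun x => decide (π x = c)) := by
    intro c hc
    split_ifs with hc'
    · have h2 : k₂ + 1 ≤ cutSize s.unprot (fun x => decide (π x = c)) := by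
        rw [Finset.mem_insert, Finset.mem_singleton] at hc'
        refine h.2 _ i j ?_ (hp c)
        rcases hc' with rfl | rfl
        · simpa using hij.symm
        · simpa using hij
      omega
    · obtain ⟨u, -, rfl⟩ := Finset.mem_image.1 hc
      obtain ⟨v, hv⟩ := hne (π u)
      exact h.1 _ u v (by simpa using hv) (hp _)
  refine le_trans (le_of_eq ?_) (Finset.sum_le_sum h1)
  rw [Finset.sum_add_distrib, Finset.sum_const, smul_eq_mul, Finset.sum_ite_mem,
    Finset.inter_eq_right.2, Finset.sum_const, Finset.card_pair hij, smul_eq_mul]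
  intro c hc
  rw [Finset.mem_insert, Finset.mem_singleton] at hc
  rcases hc with rfl | rfl <;> simp

/-- Counting the links at the nodes, in the absence of protected links. -/
theorem IsResistant.degree_sum_le {s : Network n₁ n₂} {k₁ k₂ : ℕ}
    (h : s.IsResistant k₁ k₂) (hs : s.prot = ∅) (hn₂ : 2 ≤ n₂) :
    n₁ * (k₁ + 1) + n₂ * (k₂ + 1) ≤ 2 * s.unprot.card := by
  rw [isResistant_iff] at h
  refine le_trans ?_ (sum_cutSize_fiber_le s.unprot id Finset.univ)
  have hp : ∀ P : Node n₁ n₂ → Bool, ∀ e ∈ s.prot, ¬ Sym2.Crosses P e := by simp [hs]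
  rw [Fintype.sum_sum_type]
  refine add_le_add ?_ ?_
  · have : ∑ _x : Fin n₁, (k₁ + 1) = n₁ * (k₁ + 1) := by simp
    rw [← this]
    exact Finset.sum_le_sum fun i _ => h.1 _ (Sum.inl i) (Sum.inr ⟨0, by omega⟩) (by simp) (hp _)
  · have : ∑ _x : Fin n₂, (k₂ + 1) = n₂ * (k₂ + 1) := by simp
    rw [← this]
    refine Finset.sum_le_sum fun i _ => ?_
    have : Nontrivial (Fin n₂) := Fin.nontrivial_iff_two_le.2 hn₂
    obtain ⟨j, hj⟩ := exists_ne i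
    exact h.2 _ i j (by simpa using hj) (hp _)

/-- Counting the links at the nodes, in the absence of protected links, for the first resistance
alone. -/
theorem IsResistant.degree_sum_le' {s : Network n₁ n₂} {k₁ k₂ : ℕ}
    (h : s.IsResistant k₁ k₂) (hs : s.prot = ∅) (hn₁ : 1 ≤ n₁) (hn₂ : 1 ≤ n₂) :
    (n₁ + n₂) * (k₁ + 1) ≤ 2 * s.unprot.card := by
  rw [isResistant_iff] at h
  refine le_trans ?_ (sum_cutSize_fiber_le s.unprot id Finset.univ)
  have hp : ∀ P : Node n₁ n₂ → Bool, ∀ e ∈ s.prot, ¬ Sym2.Crosses P e := by simp [hs]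
  have : ∑ _x : Node n₁ n₂, (k₁ + 1) = (n₁ + n₂) * (k₁ + 1) := by simp
  rw [← this]
  refine Finset.sum_le_sum fun u _ => ?_
  rcases u with i | i
  · exact h.1 _ (Sum.inl i) (Sum.inr ⟨0, by omega⟩) (by simp) (hp _)
  · exact h.1 _ (Sum.inr i) (Sum.inl ⟨0, by omega⟩) (by simp) (hp _)

end Network

/-! ### Circulant and antipodal links -/

/-- The links of the circulant graph on the cyclic sequence `φ` of length `n` that join nodes at
distance at most `h`. -/
def circulantLinks {α : Type*} [DecidableEq α] (φ : ℕ → α) (n h : ℕ) : Finset (Sym2 α) :=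
  (Finset.range n ×ˢ Finset.Icc 1 h).image fun p => s(φ p.1, φ (p.1 + p.2))

/-- The links between opposite nodes of the cyclic sequence `φ` of length `2 * m`. -/
def antipodalLinks {α : Type*} [DecidableEq α] (φ : ℕ → α) (m : ℕ) : Finset (Sym2 α) :=
  (Finset.range m).image fun x => s(φ x, φ (x + m))

/-- `φ` enumerates `n` distinct elements periodically. -/
def IsCyclicEnum {α : Type*} (φ : ℕ → α) (n : ℕ) : Prop := ∀ x y, φ x = φ y ↔ x ≡ y [MOD n]

section Cyclic

variable {α : Type*} {φ : ℕ → α} {n h m : ℕ}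

theorem IsCyclicEnum.periodic (hφ : IsCyclicEnum φ n) {β : Type*} (P : α → β) :
    Function.Periodic (fun x => P (φ x)) n := fun x =>
  congrArg P ((hφ _ _).2 (by simp [Nat.ModEq]))

theorem Nat.ModEq.dvd_of_add_right {n x d : ℕ} (h : x + d ≡ x [MOD n]) : n ∣ d := by
  have : x + d ≡ x + 0 [MOD n] := h
  exact (Nat.modEq_zero_iff_dvd).1 (Nat.ModEq.add_left_cancel' x this)

/-- If the two links agree with reversed orientation, going round gives `d + e ≡ 0` modulo `n`,
which `hde` excludes. -/
theorem IsCyclicEnum.eq_of_link_eq (hφ : IsCyclicEnum φ n) {x y d e : ℕ} (hx : x < n) (hy : y < n)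
    (hd : d < n) (he : e < n) (hde : ¬ n ∣ d + e)
    (heq : s(φ x, φ (x + d)) = s(φ y, φ (y + e))) : x = y ∧ d = e := by
  rw [Sym2.eq_iff, hφ, hφ, hφ, hφ] at heq
  rcases heq with ⟨h1, h2⟩ | ⟨h1, h2⟩
  · have hxy := h1.eq_of_lt_of_lt hx hy
    subst hxy
    exact ⟨rfl, (Nat.ModEq.add_left_cancel' x h2).eq_of_lt_of_lt hd he⟩
  · have h3 : y + (d + e) ≡ y [MOD n] := by
      have := (h1.symm.add_right d).trans h2
      rwa [show y + (d + e) = y + e + d by ring]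
    exact absurd h3.dvd_of_add_right hde

theorem IsCyclicEnum.injOn_circulantLinks (hφ : IsCyclicEnum φ n) (hn : 2 * h < n) :
    Set.InjOn (fun p : ℕ × ℕ => s(φ p.1, φ (p.1 + p.2)))
      (Finset.range n ×ˢ Finset.Icc 1 h : Finset (ℕ × ℕ)) := by
  rintro ⟨x, d⟩ hx ⟨y, e⟩ hy heq
  simp only [Finset.coe_product, Set.mem_prod, Finset.mem_coe, Finset.mem_range,
    Finset.mem_Icc] at hx hy
  have := hφ.eq_of_link_eq hx.1 hy.1 (d := d) (e := e) (by omega) (by omega)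
    (fun hdvd => by have := Nat.le_of_dvd (by omega) hdvd; omega) heq
  rw [Prod.mk.injEq]
  exact this

variable [DecidableEq α]

theorem mem_circulantLinks {e : Sym2 α} : e ∈ circulantLinks φ n h ↔
    ∃ x d, x < n ∧ 1 ≤ d ∧ d ≤ h ∧ s(φ x, φ (x + d)) = e := by
  simp [circulantLinks, and_assoc]

theorem mem_antipodalLinks {e : Sym2 α} : e ∈ antipodalLinks φ m ↔
    ∃ x, x < m ∧ s(φ x, φ (x + m)) = e := by
  simp [antipodalLinks]

theorem IsCyclicEnum.card_circulantLinks (hφ : IsCyclicEnum φ n) (hn : 2 * h < n) :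
    (circulantLinks φ n h).card = n * h := by
  rw [circulantLinks, Finset.card_image_of_injOn (hφ.injOn_circulantLinks hn)]
  simp

theorem IsCyclicEnum.cutSize_circulantLinks (hφ : IsCyclicEnum φ n) (hn : 2 * h < n)
    (P : α → Bool) : cutSize (circulantLinks φ n h) P =
      ∑ x ∈ Finset.range n, changeCount (fun x => P (φ x)) h x := by
  rw [cutSize, circulantLinks, Finset.filter_image, Finset.card_image_of_injOn
    ((hφ.injOn_circulantLinks hn).mono (by
      exact_mod_cast Finset.filter_subset _ _)), Finset.card_filter, Finset.sum_product]
  refine Finset.sum_congr rfl fun x _ => ?_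
  rw [changeCount, Finset.card_filter]
  exact Finset.sum_congr rfl fun d _ => by simp

theorem IsCyclicEnum.two_mul_le_cutSize (hφ : IsCyclicEnum φ n) (hn : 2 * h < n)
    {P : α → Bool} {x y : ℕ} (hxy : P (φ x) ≠ P (φ y)) :
    2 * h ≤ cutSize (circulantLinks φ n h) P := by
  rw [hφ.cutSize_circulantLinks hn]
  exact (hφ.periodic P).two_mul_le_sum_changeCount (by omega) hxy

theorem IsCyclicEnum.not_isDiag_of_mem_circulantLinks (hφ : IsCyclicEnum φ n) (hn : h < n)
    {e : Sym2 α} (he : e ∈ circulantLinks φ n h) : ¬ e.IsDiag := by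
  obtain ⟨x, d, -, hd, hd', rfl⟩ := mem_circulantLinks.1 he
  rw [Sym2.mk_isDiag_iff, hφ]
  intro hx
  have := Nat.le_of_dvd (by omega) hx.symm.dvd_of_add_right
  omega

theorem IsCyclicEnum.not_isDiag_of_mem_antipodalLinks (hφ : IsCyclicEnum φ (2 * m))
    {e : Sym2 α} (he : e ∈ antipodalLinks φ m) : ¬ e.IsDiag := by
  obtain ⟨x, hx', rfl⟩ := mem_antipodalLinks.1 he
  rw [Sym2.mk_isDiag_iff, hφ]
  intro hx
  have := Nat.le_of_dvd (by omega) hx.symm.dvd_of_add_right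
  omega

theorem IsCyclicEnum.card_antipodalLinks (hφ : IsCyclicEnum φ (2 * m)) :
    (antipodalLinks φ m).card = m := by
  rw [antipodalLinks, Finset.card_image_of_injOn, Finset.card_range]
  intro x hx y hy heq
  simp only [Finset.coe_range, Set.mem_Iio] at hx hy
  simp only [Sym2.eq_iff, hφ _ _] at heq
  rcases heq with ⟨h1, -⟩ | ⟨h1, -⟩
  · exact h1.eq_of_lt_of_lt (by omega) (by omega)
  · have := h1.eq_of_lt_of_lt (by omega) (by omega)
    omega

theorem IsCyclicEnum.disjoint_antipodalLinks (hφ : IsCyclicEnum φ (2 * m)) (hm : h < m) :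
    Disjoint (circulantLinks φ (2 * m) h) (antipodalLinks φ m) := by
  rw [Finset.disjoint_left]
  intro e he he'
  obtain ⟨x, d, hx, hd, hd', rfl⟩ := mem_circulantLinks.1 he
  obtain ⟨y, hy, heq⟩ := mem_antipodalLinks.1 he'
  have := hφ.eq_of_link_eq (by omega) (by omega) (by omega) (by omega)
    (fun hdvd => by have := Nat.le_of_dvd (by omega) hdvd; omega) heq
  omega

theorem one_le_cutSize_antipodalLinks {P : α → Bool} {x : ℕ} (hx : x < m)
    (hP : P (φ x) ≠ P (φ (x + m))) : 1 ≤ cutSize (antipodalLinks φ m) P :=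
  Finset.card_pos.2 ⟨s(φ x, φ (x + m)), Finset.mem_filter.2
    ⟨mem_antipodalLinks.2 ⟨x, hx, rfl⟩, by simpa using hP⟩⟩

end Cyclic

/-! ### The extremal network without protected links -/

/-- A cyclic enumeration of all nodes in which the nodes of type 2 are `g` steps apart. -/
theorem exists_spaced_enum {n₁ n₂ g : ℕ} (hg : 0 < g) (hn : n₂ * g ≤ n₁ + n₂)
    (hpos : 0 < n₁ + n₂) :
    ∃ φ : ℕ → Node n₁ n₂, IsCyclicEnum φ (n₁ + n₂) ∧ Function.Surjective φ ∧
      ∀ j : Fin n₂, φ (j * g) = Sum.inr j := by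
  classical
  have hlt : ∀ j : Fin n₂, j.1 * g < n₁ + n₂ := fun j =>
    lt_of_lt_of_le ((Nat.mul_lt_mul_right hg).2 j.2) hn
  obtain ⟨e, he⟩ := Finset.exists_equiv_extend_of_card_eq (α := Node n₁ n₂)
    (t := Finset.range (n₁ + n₂)) (by simp) (s := Finset.univ.image Sum.inr)
    (f := Sum.elim (fun _ => 0) (fun j => j.1 * g)) (by
      intro x hx
      simp only [Finset.mem_image, Finset.mem_univ, true_and, exists_exists_eq_and] at hx
      obtain ⟨j, rfl⟩ := hx
      exact Finset.mem_range.2 (hlt j)) (by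
      intro x hx y hy hxy
      simp only [Finset.coe_image, Finset.coe_univ, Set.image_univ, Set.mem_range] at hx hy
      obtain ⟨i, rfl⟩ := hx
      obtain ⟨j, rfl⟩ := hy
      have : i.1 = j.1 := Nat.eq_of_mul_eq_mul_right hg hxy
      rw [Fin.ext this])
  have hmem : ∀ x, x % (n₁ + n₂) ∈ Finset.range (n₁ + n₂) := fun x =>
    Finset.mem_range.2 (Nat.mod_lt _ hpos)
  refine ⟨fun x => e.symm ⟨x % (n₁ + n₂), hmem x⟩, ?_, ?_, ?_⟩
  · intro x y
    simp [Nat.ModEq]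
  · intro v
    refine ⟨e v, ?_⟩
    rw [Equiv.symm_apply_eq]
    exact Subtype.ext (Nat.mod_eq_of_lt (Finset.mem_range.1 (e v).2))
  · intro j
    rw [Equiv.symm_apply_eq]
    refine Subtype.ext ?_
    rw [he (Sum.inr j) (by simp)]
    exact Nat.mod_eq_of_lt (hlt j)

/-- Links within distance `h` never join two nodes that are `h + 1` steps apart. -/
theorem not_mem_circulantLinks_inr {n₁ n₂ h : ℕ} {φ : ℕ → Node n₁ n₂}
    (hφ : IsCyclicEnum φ (n₁ + n₂)) (hn : n₂ * (h + 1) ≤ n₁ + n₂)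
    (hφ₂ : ∀ j : Fin n₂, φ (j * (h + 1)) = Sum.inr j) (i j : Fin n₂) :
    s((Sum.inr i : Node n₁ n₂), Sum.inr j) ∉ circulantLinks φ (n₁ + n₂) h := by
  intro hmem
  obtain ⟨x, d, hx, hd, hd', heq⟩ := mem_circulantLinks.1 hmem
  have key : ∀ i j : Fin n₂, φ x = Sum.inr i → φ (x + d) ≠ Sum.inr j := by
    intro i j h1 h2
    have hi : (i.1 + 1) * (h + 1) ≤ n₂ * (h + 1) := Nat.mul_le_mul_right _ i.2
    have hj : (j.1 + 1) * (h + 1) ≤ n₂ * (h + 1) := Nat.mul_le_mul_right _ j.2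
    rw [Nat.add_mul, one_mul] at hi hj
    rw [← hφ₂, hφ] at h1 h2
    have h3 := h1.eq_of_lt_of_lt hx (by omega)
    have h4 := h2.eq_of_lt_of_lt (by omega) (by omega)
    have h5 : (i.1 * (h + 1) + d) % (h + 1) = d := by
      rw [add_comm, Nat.add_mul_mod_self_right, Nat.mod_eq_of_lt (by omega)]
    rw [← h3, h4, Nat.mul_mod_left] at h5
    omega
  rw [Sym2.eq_iff] at heq
  rcases heq with ⟨h1, h2⟩ | ⟨h1, h2⟩
  · exact key _ _ h1 h2
  · exact key _ _ h1 h2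

/-- An antipodally symmetric bipartition of the nodes of type 2 cuts an additional link of the
circulant graph. -/
theorem two_mul_add_one_le_cutSize {n₁ n₂ h m : ℕ} {φ : ℕ → Node n₁ n₂}
    (hφ : IsCyclicEnum φ (n₁ + n₂)) (hn : n₂ * (h + 1) ≤ n₁ + n₂) (hh : 1 ≤ h)
    (hhn : 2 * h < n₁ + n₂) (hφ₂ : ∀ j : Fin n₂, φ (j * (h + 1)) = Sum.inr j) (hm : n₂ = 2 * m)
    {P : Node n₁ n₂ → Bool} {g : ℕ → Bool} (hg : ∀ j : Fin n₂, P (Sum.inr j) = g j)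
    (hsymm : ∀ x < m, g x = g (x + m)) {i j : Fin n₂} (hij : P (Sum.inr i) ≠ P (Sum.inr j)) :
    2 * h + 1 ≤ cutSize (circulantLinks φ (n₁ + n₂) h) P := by
  rw [hφ.cutSize_circulantLinks hhn]
  have hred : ∀ i : Fin n₂, ∃ x < m, P (Sum.inr i) = g x := by
    intro i
    by_cases hi : i.1 < m
    · exact ⟨i, hi, hg i⟩
    · refine ⟨i - m, by omega, ?_⟩
      rw [hsymm _ (by omega), hg i]
      congr 1; omega
  obtain ⟨x, hx, hx'⟩ := hred i
  obtain ⟨y, hy, hy'⟩ := hred j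
  rw [hx', hy'] at hij
  -- By symmetry `g` is already nonconstant on the first half. Its change at `z` recurs at `z + m`,
  -- and the value must change back in between.
  obtain ⟨z, hz, hzg⟩ : ∃ z, z + 1 < m ∧ g z ≠ g (z + 1) := by
    rcases le_total x y with hle | hle
    · obtain ⟨z, -, h2, h3⟩ := exists_change_of_ne hle hij
      exact ⟨z, by omega, h3⟩
    · obtain ⟨z, -, h2, h3⟩ := exists_change_of_ne hle hij.symm
      exact ⟨z, by omega, h3⟩
  have hf : ∀ x < n₂, P (φ (x * (h + 1))) = g x := fun x hx => by
    rw [hφ₂ ⟨x, hx⟩, hg]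
  have e1 : (z + 1) * (h + 1) = z * (h + 1) + (h + 1) := by ring
  have e2 : (z + m) * (h + 1) = z * (h + 1) + m * (h + 1) := by ring
  have e3 : (z + 1 + m) * (h + 1) = z * (h + 1) + m * (h + 1) + (h + 1) := by ring
  have e4 : n₂ * (h + 1) = 2 * (m * (h + 1)) := by rw [hm]; ring
  have e5 : 2 * (h + 1) ≤ m * (h + 1) := Nat.mul_le_mul_right _ (by omega)
  have f0 := hf z (by omega)
  have f1 := hf (z + 1) (by omega)
  have f2 := hf (z + m) (by omega)
  have f3 := hf (z + 1 + m) (by omega)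
  rw [← hsymm z (by omega)] at f2
  rw [← hsymm (z + 1) (by omega)] at f3
  obtain ⟨a, ha1, ha2, ha⟩ := exists_change_of_ne (f := fun x => P (φ x))
    (x := z * (h + 1)) (y := (z + 1) * (h + 1)) (by omega) (by simp only [f0, f1]; exact hzg)
  obtain ⟨b, hb1, hb2, hb⟩ := exists_change_of_ne (f := fun x => P (φ x))
    (x := (z + 1) * (h + 1)) (y := (z + m) * (h + 1)) (by omega)
    (by simp only [f1, f2]; exact hzg.symm)
  obtain ⟨c, hc1, hc2, hc⟩ := exists_change_of_ne (f := fun x => P (φ x))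
    (x := (z + m) * (h + 1)) (y := (z + 1 + m) * (h + 1)) (by omega)
    (by simp only [f2, f3]; exact hzg)
  exact (hφ.periodic P).two_mul_add_one_le_sum_changeCount hh (i := a) (j := b) (l := c)
    (by omega) (by omega) (by omega) (by omega) ha hb hc

/-- The links of a network without protected links that attains the degree bound: a circulant
graph on all nodes, and links among the nodes of type 2. -/
theorem Scenario.exists_links {n₁ n₂ k₁ k₂ : ℕ} (hS : Scenario n₁ n₂ k₁ k₂) (hn₂ : 1 ≤ n₂)
    (hk : k₁ ≤ k₂) : ∃ E₁ E₂ : Finset (Sym2 (Node n₁ n₂)),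
      Disjoint E₁ E₂ ∧ (∀ e ∈ E₁ ∪ E₂, ¬ e.IsDiag) ∧
      2 * E₁.card = (n₁ + n₂) * (k₁ + 1) ∧ 2 * E₂.card = n₂ * (k₂ - k₁) ∧
      (∀ (P : Node n₁ n₂ → Bool) (u v : Node n₁ n₂), P u ≠ P v → k₁ + 1 ≤ cutSize E₁ P) ∧
      (∀ (P : Node n₁ n₂ → Bool) (i j : Fin n₂), P (Sum.inr i) ≠ P (Sum.inr j) →
        k₂ + 1 ≤ cutSize E₁ P + cutSize E₂ P) := by
  obtain ⟨h1, h2, h3, ⟨t, ht⟩, h5⟩ := hS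
  obtain ⟨h, hh⟩ : ∃ h, k₁ + 1 = 2 * h := ⟨t + 1, by omega⟩
  obtain ⟨r, rfl⟩ := Nat.exists_eq_add_of_le hk
  have hh1 : 1 ≤ h := by omega
  -- This is `n₂ * (k₁ + 1) / 2 ≤ n₁`: there is room to space the nodes of type 2 by `h + 1`.
  have hn : n₂ * (h + 1) ≤ n₁ + n₂ := by
    rw [hh] at h3
    nlinarith
  have hhn : 2 * h < n₁ + n₂ := by omega
  obtain ⟨φ, hφ, hφs, hφ₂⟩ := exists_spaced_enum (by omega) hn (by omega)
  let ψ : ℕ → Node n₁ n₂ := fun x => Sum.inr ⟨x % n₂, Nat.mod_lt _ hn₂⟩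
  have hψ : IsCyclicEnum ψ n₂ := fun x y => by simp [ψ, Nat.ModEq]
  have hψi : ∀ i : Fin n₂, ψ i = Sum.inr i := fun i => by simp [ψ, Nat.mod_eq_of_lt i.2]
  have hcut₁ : ∀ (P : Node n₁ n₂ → Bool) (u v : Node n₁ n₂), P u ≠ P v →
      2 * h ≤ cutSize (circulantLinks φ (n₁ + n₂) h) P := by
    intro P u v hP
    obtain ⟨x, rfl⟩ := hφs u
    obtain ⟨y, rfl⟩ := hφs v
    exact hφ.two_mul_le_cutSize hhn hP
  have hcut₂ : ∀ q, 2 * q < n₂ → ∀ (P : Node n₁ n₂ → Bool) (i j : Fin n₂),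
      P (Sum.inr i) ≠ P (Sum.inr j) → 2 * q ≤ cutSize (circulantLinks ψ n₂ q) P := by
    intro q hq P i j hP
    rw [← hψi, ← hψi] at hP
    exact hψ.two_mul_le_cutSize hq hP
  have hdisj : ∀ x y, s(ψ x, ψ y) ∉ circulantLinks φ (n₁ + n₂) h := fun x y =>
    not_mem_circulantLinks_inr hφ hn hφ₂ _ _
  have hdisj' : ∀ q, Disjoint (circulantLinks φ (n₁ + n₂) h) (circulantLinks ψ n₂ q) := by
    intro q
    rw [Finset.disjoint_right]
    intro e he
    obtain ⟨x, d, -, -, -, rfl⟩ := mem_circulantLinks.1 he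
    exact hdisj _ _
  rcases Nat.even_or_odd' r with ⟨q, rfl | rfl⟩
  · refine ⟨circulantLinks φ (n₁ + n₂) h, circulantLinks ψ n₂ q, hdisj' q, ?_, ?_, ?_, ?_, ?_⟩
    · intro e he
      rcases Finset.mem_union.1 he with he | he
      · exact hφ.not_isDiag_of_mem_circulantLinks (by omega) he
      · exact hψ.not_isDiag_of_mem_circulantLinks (by omega) he
    · rw [hφ.card_circulantLinks hhn, hh]; ring
    · rw [hψ.card_circulantLinks (by omega), Nat.add_sub_cancel_left]; ring
    · intro P u v hP
      rw [hh]; exact hcut₁ P u v hP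
    · intro P i j hP
      have := hcut₁ P _ _ hP
      have := hcut₂ q (by omega) P i j hP
      omega
  -- Here `k₂ + 1` is odd, so the parity condition makes `n₂` even and antipodes exist.
  · obtain ⟨m, hm⟩ : ∃ m, n₂ = 2 * m := by
      have hodd : ¬ Even (k₁ + (2 * q + 1) + 1) := by
        rw [Nat.not_even_iff_odd]; exact ⟨t + q + 1, by omega⟩
      obtain ⟨m, hm⟩ := (Nat.even_mul.1 h5).resolve_right hodd
      exact ⟨m, by omega⟩
    have hψ' : IsCyclicEnum ψ (2 * m) := hm ▸ hψ
    have hd : Disjoint (circulantLinks ψ n₂ q) (antipodalLinks ψ m) := by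
      have := hψ'.disjoint_antipodalLinks (h := q) (by omega)
      rwa [← hm] at this
    refine ⟨circulantLinks φ (n₁ + n₂) h, circulantLinks ψ n₂ q ∪ antipodalLinks ψ m,
      ?_, ?_, ?_, ?_, ?_, ?_⟩
    · rw [Finset.disjoint_union_right]
      refine ⟨hdisj' q, ?_⟩
      rw [Finset.disjoint_right]
      intro e he
      obtain ⟨x, -, rfl⟩ := mem_antipodalLinks.1 he
      exact hdisj _ _
    · intro e he
      rcases Finset.mem_union.1 he with he | he
      · exact hφ.not_isDiag_of_mem_circulantLinks (by omega) he
      · rcases Finset.mem_union.1 he with he | he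
        · exact hψ.not_isDiag_of_mem_circulantLinks (by omega) he
        · exact hψ'.not_isDiag_of_mem_antipodalLinks he
    · rw [hφ.card_circulantLinks hhn, hh]; ring
    · rw [Finset.card_union_of_disjoint hd, hψ.card_circulantLinks (by omega),
        hψ'.card_antipodalLinks, Nat.add_sub_cancel_left, mul_add, ← hm]
      ring
    · intro P u v hP
      rw [hh]; exact hcut₁ P u v hP
    · intro P i j hP
      have c1 := hcut₁ P _ _ hP
      have c2 := hcut₂ q (by omega) P i j hP
      rw [cutSize_union hd]
      -- The missing link is a circulant one if the bipartition is antipodally symmetric on type 2,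
      -- and an antipodal one otherwise.
      by_cases hsymm : ∀ x < m, P (ψ x) = P (ψ (x + m))
      · have := two_mul_add_one_le_cutSize hφ hn hh1 hhn hφ₂ hm (g := fun x => P (ψ x))
          (fun j => by rw [hψi]) hsymm hP
        omega
      · push Not at hsymm
        obtain ⟨x, hx, hxP⟩ := hsymm
        have := one_le_cutSize_antipodalLinks hx hxP
        omega

/-! ### Stars and the comparison networks -/

/-- The links that join `r` to the other nodes of `W`. -/
def starLinks {α : Type*} [DecidableEq α] (r : α) (W : Finset α) : Finset (Sym2 α) :=
  (W.erase r).image fun v => s(r, v)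

section Star

variable {α : Type*} [DecidableEq α] {r : α} {W : Finset α}

theorem card_starLinks (hr : r ∈ W) : (starLinks r W).card = W.card - 1 := by
  rw [starLinks, Finset.card_image_of_injective _ (fun u v h => Sym2.congr_right.1 h),
    Finset.card_erase_of_mem hr]

theorem not_isDiag_of_mem_starLinks {e : Sym2 α} (he : e ∈ starLinks r W) : ¬ e.IsDiag := by
  obtain ⟨v, hv, rfl⟩ := Finset.mem_image.1 he
  rw [Sym2.mk_isDiag_iff]
  exact (Finset.ne_of_mem_erase hv).symm

theorem eq_of_not_crosses_starLinks {P : α → Bool}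
    (hP : ∀ e ∈ starLinks r W, ¬ Sym2.Crosses P e) {u v : α} (hu : u ∈ W) (hv : v ∈ W) :
    P u = P v := by
  have key : ∀ u ∈ W, P r = P u := by
    intro u hu
    by_cases hur : u = r
    · rw [hur]
    · simpa using hP s(r, u) (Finset.mem_image.2 ⟨u, Finset.mem_erase.2 ⟨hur, hu⟩, rfl⟩)
  rw [← key u hu, key v hv]

end Star

namespace Network

variable {n₁ n₂ : ℕ}

theorem exists_protected_tree (hn : 1 ≤ n₂) (k₁ k₂ : ℕ) : ∃ t : Network n₁ n₂,
    t.IsResistant k₁ k₂ ∧ t.prot.card = n₁ + n₂ - 1 ∧ t.unprot = ∅ := by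
  refine ⟨⟨starLinks (Sum.inr ⟨0, hn⟩) Finset.univ, ∅, fun e => not_isDiag_of_mem_starLinks,
    by simp, by simp⟩, ?_, ?_, rfl⟩
  · rw [isResistant_iff]
    have key : ∀ P : Node n₁ n₂ → Bool,
        (∀ e ∈ starLinks (Sum.inr ⟨0, hn⟩) Finset.univ, ¬ Sym2.Crosses P e) →
          ∀ u v, P u = P v := fun P hp u v =>
      eq_of_not_crosses_starLinks hp (Finset.mem_univ u) (Finset.mem_univ v)
    exact ⟨fun P u v hP hp => absurd (key P hp _ _) hP,
      fun P i j hP hp => absurd (key P hp _ _) hP⟩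
  · simp [card_starLinks]

/-- All nodes of type 2 are joined by protected links, and the rest forms a circulant graph in
which they count as a single node. -/
theorem exists_protected_backbone {k₁ : ℕ} (hn₂ : 1 ≤ n₂) (hn₁ : k₁ + 1 ≤ n₁) (hk₁ : Odd k₁)
    (k₂ : ℕ) : ∃ t : Network n₁ n₂, t.IsResistant k₁ k₂ ∧ t.prot.card = n₂ - 1 ∧
      2 * t.unprot.card = (n₁ + 1) * (k₁ + 1) := by
  obtain ⟨h, hh⟩ : ∃ h, k₁ + 1 = 2 * h := by
    obtain ⟨t, ht⟩ := hk₁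
    exact ⟨t + 1, by omega⟩
  obtain ⟨φ₀, hφ₀, hφs, -⟩ := exists_spaced_enum (n₁ := n₁) (n₂ := 1) (g := 1) one_pos
    (by omega) (by omega)
  -- Node 0 of type 2 represents its whole layer, so the circulant never meets the other star nodes.
  let ι : Node n₁ 1 → Node n₁ n₂ := Sum.map id fun _ => ⟨0, hn₂⟩
  have hι : Function.Injective ι :=
    Function.Injective.sumMap Function.injective_id fun _ _ _ => Subsingleton.elim _ _
  have hφ : IsCyclicEnum (fun x => ι (φ₀ x)) (n₁ + 1) := fun x y => by
    rw [← hφ₀, hι.eq_iff]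
  have hstar : ∀ e ∈ starLinks (Sum.inr ⟨0, hn₂⟩ : Node n₁ n₂) (Finset.univ.image Sum.inr),
      e ∉ circulantLinks (fun x => ι (φ₀ x)) (n₁ + 1) h := by
    intro e he hc
    obtain ⟨v, hv, rfl⟩ := Finset.mem_image.1 he
    have hd := hφ.not_isDiag_of_mem_circulantLinks (by omega) hc
    obtain ⟨x, d, -, -, -, heq⟩ := mem_circulantLinks.1 hc
    rw [Finset.mem_erase, Finset.mem_image] at hv
    obtain ⟨-, j, -, rfl⟩ := hv
    have key : ∀ y (i : Fin n₂), ι (φ₀ y) = Sum.inr i → i = ⟨0, hn₂⟩ := by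
      intro y i hy
      cases hy' : φ₀ y with
      | inl a => simp [ι, hy'] at hy
      | inr a =>
        rw [hy'] at hy
        exact (Sum.inr_injective hy).symm
    refine hd ?_
    rw [Sym2.mk_isDiag_iff]
    rw [Sym2.eq_iff] at heq
    rcases heq with ⟨-, h2⟩ | ⟨h1, -⟩
    · rw [key _ _ h2]
    · rw [key _ _ h1]
  refine ⟨⟨starLinks (Sum.inr ⟨0, hn₂⟩) (Finset.univ.image Sum.inr),
    circulantLinks (fun x => ι (φ₀ x)) (n₁ + 1) h, fun e => not_isDiag_of_mem_starLinks,
    fun e => hφ.not_isDiag_of_mem_circulantLinks (by omega), Finset.disjoint_left.2 hstar⟩,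
    ?_, ?_, ?_⟩
  · have key : ∀ P : Node n₁ n₂ → Bool,
        (∀ e ∈ starLinks (Sum.inr ⟨0, hn₂⟩) (Finset.univ.image Sum.inr), ¬ Sym2.Crosses P e) →
          ∀ i j : Fin n₂, P (Sum.inr i) = P (Sum.inr j) := fun P hp i j =>
      eq_of_not_crosses_starLinks hp (by simp) (by simp)
    refine IsResistant.of_prot (k₂ := k₁) ?_ key k₂
    rw [isResistant_iff]
    refine ⟨fun P u v hP hp => ?_, fun P i j hP hp => absurd (key P hp i j) hP⟩
    have hrep : ∀ u : Node n₁ n₂, ∃ x, P (ι (φ₀ x)) = P u := by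
      rintro (i | i)
      · obtain ⟨x, hx⟩ := hφs (Sum.inl i)
        exact ⟨x, by rw [hx]; rfl⟩
      · obtain ⟨x, hx⟩ := hφs (Sum.inr 0)
        exact ⟨x, by rw [hx]; exact key P hp _ _⟩
    obtain ⟨x, hx⟩ := hrep u
    obtain ⟨y, hy⟩ := hrep v
    rw [← hx, ← hy] at hP
    rw [hh]
    exact hφ.two_mul_le_cutSize (by omega) hP
  · rw [card_starLinks (by simp), Finset.card_image_of_injective _ Sum.inr_injective]
    simp
  · rw [hφ.card_circulantLinks (by omega), hh]; ring

/-- In the considered range of parameters, the degree bound is attained. -/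
theorem exists_unprotected {k₁ k₂ : ℕ} (hS : Scenario n₁ n₂ k₁ k₂) (hn₂ : 1 ≤ n₂)
    (hk : k₁ ≤ k₂) : ∃ t : Network n₁ n₂, t.IsResistant k₁ k₂ ∧ t.prot = ∅ ∧
      2 * t.unprot.card = n₁ * (k₁ + 1) + n₂ * (k₂ + 1) := by
  obtain ⟨E₁, E₂, hd, hdiag, hc₁, hc₂, h1, h2⟩ := hS.exists_links hn₂ hk
  refine ⟨⟨∅, E₁ ∪ E₂, by simp, hdiag, by simp⟩, ?_, rfl, ?_⟩
  · rw [isResistant_iff]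
    simp only [cutSize_union hd]
    exact ⟨fun P u v hP _ => (h1 P u v hP).trans (Nat.le_add_right _ _),
      fun P i j hP _ => h2 P i j hP⟩
  · obtain ⟨r, rfl⟩ := Nat.exists_eq_add_of_le hk
    rw [Nat.add_sub_cancel_left] at hc₂
    rw [Finset.card_union_of_disjoint hd, mul_add, hc₁, hc₂]
    ring

/-- A lower second resistance is attained with one link less. -/
theorem exists_unprotected_of_succ {k₁ k₂ : ℕ} (hS : Scenario n₁ n₂ k₁ (k₂ + 1)) (hn₂ : 1 ≤ n₂)
    (hk : k₁ ≤ k₂) : ∃ t : Network n₁ n₂, t.IsResistant k₁ k₂ ∧ t.prot = ∅ ∧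
      2 * t.unprot.card < n₁ * (k₁ + 1) + n₂ * (k₂ + 1 + 1) := by
  obtain ⟨E₁, E₂, hd, hdiag, hc₁, hc₂, h1, h2⟩ := hS.exists_links hn₂ (by omega)
  obtain ⟨r, rfl⟩ := Nat.exists_eq_add_of_le hk
  rw [show k₁ + r + 1 - k₁ = r + 1 by omega] at hc₂
  have hpos : 0 < n₂ * (r + 1) := Nat.mul_pos hn₂ (Nat.succ_pos r)
  -- The link is taken from `E₂`, since `E₁` alone guarantees the first resistance.
  obtain ⟨e, he⟩ := Finset.card_pos.1 (show 0 < E₂.card by omega)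
  have hd' : Disjoint E₁ (E₂.erase e) := hd.mono_right (Finset.erase_subset _ _)
  refine ⟨⟨∅, E₁ ∪ E₂.erase e, by simp, fun e' he' => hdiag e' (Finset.union_subset_union_right
    (Finset.erase_subset _ _) he'), by simp⟩, ?_, rfl, ?_⟩
  · rw [isResistant_iff]
    simp only [cutSize_union hd']
    refine ⟨fun P u v hP _ => (h1 P u v hP).trans (Nat.le_add_right _ _), fun P i j hP _ => ?_⟩
    have := h2 P i j hP
    have := le_cutSize_erase E₂ e P
    omega
  · have hlt := Finset.card_erase_lt_of_mem he
    have heq : n₁ * (k₁ + 1) + n₂ * (k₁ + r + 1 + 1) =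
        (n₁ + n₂) * (k₁ + 1) + n₂ * (r + 1) := by ring
    rw [Finset.card_union_of_disjoint hd', heq, ← hc₁, ← hc₂]
    omega

/-! ### Optimality -/

theorem not_isOptimal_of_card_lt {s t : Network n₁ n₂} {cP cNP : ℝ} {k₁ k₂ : ℕ} (hNP : 0 < cNP)
    (hprot : t.prot.card = s.prot.card) (ht : t.IsResistant k₁ k₂)
    (hlt : t.unprot.card < s.unprot.card) : ¬ s.IsOptimal cP cNP k₁ k₂ := by
  intro hs
  have h1 := hs.2 t ht
  have h2 : (t.unprot.card : ℝ) < s.unprot.card := by exact_mod_cast hlt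
  rw [cost, cost, hprot] at h1
  have := mul_lt_mul_of_pos_left h2 hNP
  linarith

/-- In an optimal network with the number of protected links of a spanning tree of the nodes of
type 2, these links do join all nodes of type 2. -/
theorem IsSD.eq_of_not_crosses {s : Network n₁ n₂} {k₁ k₂ : ℕ} {cP cNP : ℝ}
    (hS : Scenario n₁ n₂ k₁ k₂) (hn₂ : 1 ≤ n₂) (hk : k₁ ≤ k₂) (hNP : 0 < cNP)
    (hs : s.IsSD (n₂ - 1) k₁ k₂) (ho : s.IsOptimal cP cNP k₁ k₂) (P : Node n₁ n₂ → Bool)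
    (hP : ∀ e ∈ s.prot, ¬ Sym2.Crosses P e) (i j : Fin n₂) :
    P (Sum.inr i) = P (Sum.inr j) := by
  obtain ⟨π, hπ, hπP, hcard⟩ := exists_classes s.prot
  by_contra hij
  have hπij : π (Sum.inr i) ≠ π (Sum.inr j) := fun h => hij (hπP P hP _ _ h)
  have hn2 : 2 ≤ n₂ := by
    have : i ≠ j := fun h => hij (by rw [h])
    have := i.2; have := j.2
    rcases Nat.lt_or_ge 1 n₂ with h | h
    · exact h
    · exact absurd (Fin.ext (by omega)) ‹i ≠ j›
  obtain ⟨t, ht, htp, htc⟩ := exists_protected_backbone hn₂ hS.1 hS.2.2.2.1 k₂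
  have h1 := hs.1.mul_card_classes_le hπ hπij hk
  have h2 := hs.2.2 t ht htp
  have h3 : n₁ + 1 ≤ (Finset.univ.image π).card := by
    have := hs.2.1
    simp only [Fintype.card_sum, Fintype.card_fin] at hcard
    omega
  have h4 : (n₁ + 1) * (k₁ + 1) ≤ (Finset.univ.image π).card * (k₁ + 1) :=
    Nat.mul_le_mul_right _ h3
  -- The backbone has `(n₁ + 1) * (k₁ + 1) / 2` non-protected links, so there is no room for the
  -- surplus `2 * (k₂ - k₁)`.
  obtain rfl : k₂ = k₁ := by omega
  have h5 : 2 * s.unprot.card = (n₁ + 1) * (k₂ + 1) := by omega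
  obtain ⟨T, hT, hTp, hTu⟩ := exists_protected_tree (n₁ := n₁) hn₂ k₂ k₂
  obtain ⟨U, hU, hUp, hUu⟩ := exists_unprotected hS hn₂ hk
  have o1 := ho.2 T hT
  have o2 := ho.2 U hU
  rw [cost, cost, hs.2.1, hTp, hTu] at o1
  rw [cost, cost, hs.2.1, hUp] at o2
  obtain ⟨m, rfl⟩ : ∃ m, n₂ = m + 1 := ⟨n₂ - 1, by omega⟩
  rw [show n₁ + (m + 1) - 1 = n₁ + m by omega] at o1
  rw [Nat.add_sub_cancel] at o1 o2
  have hm : (0 : ℝ) < m := by exact_mod_cast (show 0 < m by omega)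
  have h5' : 2 * (s.unprot.card : ℝ) = (n₁ + 1) * (k₂ + 1) := by exact_mod_cast h5
  have hUu' : 2 * (U.unprot.card : ℝ) = n₁ * (k₂ + 1) + (m + 1) * (k₂ + 1) := by
    exact_mod_cast hUu
  simp only [Finset.card_empty, Nat.cast_zero, Nat.cast_add, mul_zero, add_zero, zero_add]
    at o1 o2
  -- Not protecting at all is no cheaper, which bounds `cP` above. With this bound the protected
  -- tree costs strictly less than `s`.
  have hcP : cP ≤ cNP * (k₂ + 1) / 2 := by
    refine le_of_mul_le_mul_right ?_ hm
    have e1 : cNP * s.unprot.card = cNP * ((n₁ + 1) * (k₂ + 1)) / 2 := by rw [← h5']; ring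
    have e2 : cNP * U.unprot.card = cNP * (n₁ * (k₂ + 1) + (m + 1) * (k₂ + 1)) / 2 := by
      rw [← hUu']; ring
    rw [e1, e2] at o2
    linarith
  have e1 : cNP * s.unprot.card = cNP * ((n₁ + 1) * (k₂ + 1)) / 2 := by rw [← h5']; ring
  rw [e1] at o1
  have h6 : cP * n₁ ≤ cNP * (k₂ + 1) / 2 * n₁ := mul_le_mul_of_nonneg_right hcP (Nat.cast_nonneg _)
  have h7 : 0 < cNP * ((k₂ : ℝ) + 1) := by positivity
  linarith

/-- The resistances of a network with the minimal number of non-protected links are bounded by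
the degrees. -/
theorem IsSD.resistance_le {s : Network n₁ n₂} {k₁ k₂ l₁ l₂ : ℕ} (hS : Scenario n₁ n₂ k₁ k₂)
    (hn₁ : 1 ≤ n₁) (hn₂ : 1 ≤ n₂) (hk : k₁ ≤ k₂) (hs : s.IsSD 0 k₁ k₂)
    (hl : s.IsResistant l₁ l₂) : l₁ ≤ k₁ ∧ (2 ≤ n₂ → l₂ ≤ k₂) := by
  have hprot : s.prot = ∅ := Finset.card_eq_zero.1 hs.2.1
  obtain ⟨t, ht, htp, htu⟩ := exists_unprotected hS hn₂ hk
  have hle := hs.2.2 t ht (by rw [htp, Finset.card_empty])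
  rcases hn₂.eq_or_lt with rfl | hn2
  -- With a single node of type 2 the second resistance is vacuous, so only `l₁` can be bounded.
  · have hkk : k₂ = k₁ := by have := hS.2.1; omega
    subst hkk
    refine ⟨?_, fun h => by omega⟩
    have h1 := hl.degree_sum_le' hprot hn₁ le_rfl
    have h2 : (n₁ + 1) * (l₁ + 1) ≤ (n₁ + 1) * (k₂ + 1) := by
      have : (n₁ + 1) * (k₂ + 1) = n₁ * (k₂ + 1) + 1 * (k₂ + 1) := by ring
      omega
    have := Nat.le_of_mul_le_mul_left h2 (Nat.succ_pos _)
    omega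
  -- At the coordinatewise maximum both summands of the degree bound dominate those for `(k₁, k₂)`,
  -- while their sum does not exceed it; so both agree.
  · have hmax : s.IsResistant (max k₁ l₁) (max k₂ l₂) := by
      constructor
      · rcases max_choice k₁ l₁ with h | h <;> rw [h]
        exacts [hs.1.1, hl.1]
      · rcases max_choice k₂ l₂ with h | h <;> rw [h]
        exacts [hs.1.2, hl.2]
    have h1 := hmax.degree_sum_le hprot hn2
    have h2 : n₁ * (k₁ + 1) ≤ n₁ * (max k₁ l₁ + 1) :=
      Nat.mul_le_mul_left _ (Nat.succ_le_succ (le_max_left _ _))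
    have h3 : n₂ * (k₂ + 1) ≤ n₂ * (max k₂ l₂ + 1) :=
      Nat.mul_le_mul_left _ (Nat.succ_le_succ (le_max_left _ _))
    have h4 := Nat.le_of_mul_le_mul_left
      (show n₁ * (max k₁ l₁ + 1) ≤ n₁ * (k₁ + 1) by omega) hn₁
    have h5 := Nat.le_of_mul_le_mul_left
      (show n₂ * (max k₂ l₂ + 1) ≤ n₂ * (k₂ + 1) by omega) hn₂
    exact ⟨by omega, fun _ => by omega⟩

/-- For `n₂ ≥ 2` both resistances must drop, so deleting any link of `s` leaves a cheaper resistant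
network; for `n₂ = 1` only the first one matters. -/
theorem IsSD.not_isOptimal_of_ne {s : Network n₁ n₂} {k₁ k₂ l₁ l₂ : ℕ} {cP cNP : ℝ}
    (hS : Scenario n₁ n₂ k₁ k₂) (hn₁ : 1 ≤ n₁) (hn₂ : 1 ≤ n₂) (hk : k₁ ≤ k₂) (hNP : 0 < cNP)
    (hs : s.IsSD 0 k₁ k₂) (h₁ : l₁ ≠ k₁) (h₂ : l₂ ≠ k₂) : ¬ s.IsOptimal cP cNP l₁ l₂ := by
  intro ho
  obtain ⟨hl₁, hl₂⟩ := hs.resistance_le hS hn₁ hn₂ hk ho.1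
  obtain ⟨a, rfl⟩ : ∃ a, k₁ = a + 1 := ⟨k₁ - 1, by omega⟩
  obtain ⟨b, rfl⟩ : ∃ b, k₂ = b + 1 := ⟨k₂ - 1, by omega⟩
  have hprot : s.prot = ∅ := Finset.card_eq_zero.1 hs.2.1
  have hdeg := hs.1.degree_sum_le' hprot hn₁ hn₂
  have hpos : 0 < (n₁ + n₂) * (a + 1 + 1) := by positivity
  obtain ⟨e, he⟩ := Finset.card_pos.1 (show 0 < s.unprot.card by omega)
  obtain ⟨t, ht, htp, htc⟩ := hs.1.exists_remove he
  refine not_isOptimal_of_card_lt hNP (by rw [htp]) ?_ (by omega) ho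
  rcases hn₂.eq_or_lt with rfl | hn2
  · exact (ht.mono (show l₁ ≤ a by omega) le_rfl).of_prot
      (fun P _ i j => by rw [Subsingleton.elim i j]) l₂
  · have := hl₂ hn2
    exact ht.mono (by omega) (by omega)

/-- If only `l₂` drops, a link among the nodes of type 2 can be spared; if only `l₁` drops,
admissibility of `(l₁, l₂)` supplies a network attaining the smaller degree bound. -/
theorem IsSD.not_isOptimal {s : Network n₁ n₂} {k₁ k₂ l₁ l₂ : ℕ} {cP cNP : ℝ}
    (hS : Scenario n₁ n₂ k₁ k₂) (hn₁ : 1 ≤ n₁) (hn₂ : 1 ≤ n₂) (hk : k₁ ≤ k₂) (hNP : 0 < cNP)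
    (hs : s.IsSD 0 k₁ k₂) (hl : l₁ ≤ l₂) (hne : (l₁, l₂) ≠ (k₁, k₂))
    (h : (2 ≤ n₂ ∧ k₁ ≤ l₁) ∨ Scenario n₁ n₂ l₁ l₂) : ¬ s.IsOptimal cP cNP l₁ l₂ := by
  intro ho
  by_cases hboth : l₁ ≠ k₁ ∧ l₂ ≠ k₂
  · exact hs.not_isOptimal_of_ne hS hn₁ hn₂ hk hNP hboth.1 hboth.2 ho
  rw [Ne, Prod.mk.injEq] at hne
  obtain ⟨hl₁, hl₂⟩ := hs.resistance_le hS hn₁ hn₂ hk ho.1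
  -- If `n₂ = 1`, admissibility forces `l₁ = l₂` and `k₁ = k₂`, so distinct pairs would differ in
  -- both coordinates.
  have hn2 : 2 ≤ n₂ := by
    rcases h with h | h
    · exact h.1
    · have := h.2.1
      have := hS.2.1
      by_contra hlt
      obtain rfl : n₂ = 1 := by omega
      omega
  have hl₂' := hl₂ hn2
  have hprot : s.prot = ∅ := Finset.card_eq_zero.1 hs.2.1
  have hdeg := hs.1.degree_sum_le hprot hn2
  by_cases he : l₁ = k₁
  · subst he
    obtain ⟨b, rfl⟩ : ∃ b, k₂ = b + 1 := ⟨k₂ - 1, by omega⟩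
    obtain ⟨t, ht, htp, htc⟩ := exists_unprotected_of_succ hS hn₂ (by omega)
    exact not_isOptimal_of_card_lt hNP (by rw [htp, hprot])
      (ht.mono le_rfl (by omega)) (by omega) ho
  · have hlk : l₂ = k₂ := by
      by_contra h'
      exact hboth ⟨he, h'⟩
    subst hlk
    have hS' : Scenario n₁ n₂ l₁ l₂ := h.resolve_left fun h' => by omega
    obtain ⟨t, ht, htp, htc⟩ := exists_unprotected hS' hn₂ hl
    have hlt : n₁ * (l₁ + 1) < n₁ * (k₁ + 1) := Nat.mul_lt_mul_of_pos_left (by omega) hn₁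
    exact not_isOptimal_of_card_lt hNP (by rw [htp, hprot]) ht (by omega) ho

end Network

theorem corollary4 (n₁ n₂ k₁ k₂ : ℕ) (cP cNP : ℝ)
    (hn₁ : 1 ≤ n₁) (hn₂ : 1 ≤ n₂) (hk : k₁ ≤ k₂) (hNP : 0 < cNP) (hP : cNP ≤ cP) :
    (∀ s : Network n₁ n₂, s.IsSD (n₁ + n₂ - 1) k₁ k₂ → s.IsOptimal cP cNP k₁ k₂ →
      ∀ k₁' k₂' : ℕ, k₁ < k₁' → k₂ < k₂' → s.IsOptimal cP cNP k₁' k₂') ∧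
    (Scenario n₁ n₂ k₁ k₂ →
      (∀ s : Network n₁ n₂, s.IsSD (n₂ - 1) k₁ k₂ → s.IsOptimal cP cNP k₁ k₂ →
        ∀ k₂' : ℕ, k₂ < k₂' → s.IsOptimal cP cNP k₁ k₂') ∧
      (∀ s : Network n₁ n₂, s.IsSD 0 k₁ k₂ → s.IsOptimal cP cNP k₁ k₂ →
        (∀ k₁' k₂' : ℕ, k₁' ≠ k₁ → k₂' ≠ k₂ → ¬ s.IsOptimal cP cNP k₁' k₂') ∧
        (∀ k₁' k₂' : ℕ, k₁' ≤ k₂' → (k₁', k₂') ≠ (k₁, k₂) →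
          (2 ≤ n₂ ∧ k₁ ≤ k₁') ∨ Scenario n₁ n₂ k₁' k₂' →
          ¬ s.IsOptimal cP cNP k₁' k₂'))) := by

  refine ⟨fun s hs ho k₁' k₂' h₁ h₂ => ?_, fun hS => ⟨fun s hs ho k₂' h₂ => ?_,
    fun s hs _ => ⟨fun k₁' k₂' h₁ h₂ => hs.not_isOptimal_of_ne hS hn₁ hn₂ hk hNP h₁ h₂,
      fun k₁' k₂' hl hne h => hs.not_isOptimal hS hn₁ hn₂ hk hNP hl hne h⟩⟩⟩
  · refine ho.of_isResistant h₁.le h₂.le ?_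
    obtain ⟨t, ht, htp, htu⟩ := Network.exists_protected_tree (n₁ := n₁) hn₂ k₁ k₂
    have hle := hs.2.2 t ht htp
    rw [htu, Finset.card_empty, Nat.le_zero] at hle
    have h := Network.isResistant_iff.1 hs.1
    rw [Network.isResistant_iff]
    -- With `s.unprot` empty, such a cut would need `k + 1 ≤ 0` crossing links.
    refine ⟨fun P u v hP hp => ?_, fun P i j hP hp => ?_⟩
    · have := h.1 P u v hP hp
      have := Finset.card_filter_le s.unprot (Sym2.Crosses P)
      rw [cutSize] at *
      omega
    · have := h.2 P i j hP hp
      have := Finset.card_filter_le s.unprot (Sym2.Crosses P)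
      rw [cutSize] at *
      omega
  · exact ho.of_isResistant le_rfl h₂.le
      (hs.1.of_prot (hs.eq_of_not_crosses hS hn₂ hk hNP ho) k₂')
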